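/- There is a universal constant $C>0$ such that for every real $p>1$ and every integer $j\ge 1$ there exists a function $u_{p,j}:\overline\Omega\to\mathbb R$, where $\Omega=(0,1)^2$, of class $C^1(\overline\Omega)$ and with weak second derivatives $\partial_{ik}u_{p,j}\in L^1(\Omega)$, with the following properties: (a) $u_{p,j}(x)=\frac{|x|^2}{2}$ and $Du_{p,j}(x)=x$ for every $x\in\partial\Omega$; (b) $\left\|u_{p,j}-\frac{|x|^2}{2}\right\|_{W^{1,\infty}(\Omega)}\le\frac1j$, where $\|v\|_{W^{1,\infty}(\Omega)}=\|v\|_{L^\infty(\Omega)}+\sum_{i=1}^2\|\partial_iv\|_{L^\infty(\Omega)}$; (c) $\Delta u_{p,j}\ge 0$ in $\Omega$ in the sense of distributions; (d) $\|D^2u_{p,j}\|_{L^1(\Omega)}=\int_\Omega\sum_{i,k=1}^2|\partial_{ik}u_{p,j}|\,dx\le C$; (e) $\int_\Omega(\partial_{ii}u_{p,j})_-^p\,dx\ge j$ for $i=1,2$, where $t_-=\max(-t,0)$ (the integral takes values in $[0,\infty]$). -/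

import Mathlib

open MeasureTheory Set
open scoped Distributions Laplacian ENNReal

/-- The Euclidean plane. -/
abbrev Plane : Type := EuclideanSpace ℝ (Fin 2)

/-- The `i`-th (classical) partial derivative. -/
noncomputable def partialDeriv (i : Fin 2) (f : Plane → ℝ) (x : Plane) : ℝ :=
  fderiv ℝ f x (EuclideanSpace.single i 1)

/-- The open unit square `(0,1)²`. -/
def unitSquare : TopologicalSpace.Opens Plane where
  carrier := {x | ∀ i, x i ∈ Ioo (0 : ℝ) 1}
  is_open' := by
    have h : {x : Plane | ∀ i, x i ∈ Ioo (0 : ℝ) 1} =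
        ⋂ i, (fun x : Plane => x i) ⁻¹' Ioo (0 : ℝ) 1 := by
      ext x
      simp
    rw [h]
    exact isOpen_iInter_of_finite fun i => isOpen_Ioo.preimage (by fun_prop)

/-- `g` is the weak (distributional) `i`-th partial derivative of `v` in `Ω`. -/
def HasWeakPartial (Ω : TopologicalSpace.Opens Plane) (i : Fin 2) (v g : Plane → ℝ) : Prop :=
  LocallyIntegrableOn v Ω ∧ LocallyIntegrableOn g Ω ∧
    ∀ φ : 𝓓(Ω, ℝ), ∫ x in Ω, v x * partialDeriv i φ x = -∫ x in Ω, g x * φ x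

/-- The functions `H i k` (`i, k = 1, 2`) are the weak (distributional) second derivatives
`∂_{ik} v` in `Ω`. -/
def HasWeakHessian (Ω : TopologicalSpace.Opens Plane) (v : Plane → ℝ)
    (H : Fin 2 → Fin 2 → Plane → ℝ) : Prop :=
  LocallyIntegrableOn v Ω ∧ ∀ i k, LocallyIntegrableOn (H i k) Ω ∧
    ∀ φ : 𝓓(Ω, ℝ),
      ∫ x in Ω, v x * partialDeriv i (partialDeriv k φ) x = ∫ x in Ω, H i k x * φ x

/-- The norm `‖v‖_{L^∞(Ω)} + ∑ᵢ ‖∂ᵢ v‖_{L^∞(Ω)}` of `W^{1,∞}(Ω)`, with values in `[0,∞]`. The weak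
gradient `g` is unique up to null sets, so the infimum is over one value; it is `∞` if `v` has no
weak gradient. -/
noncomputable def w1InftyNorm (Ω : TopologicalSpace.Opens Plane) (v : Plane → ℝ) : ℝ≥0∞ :=
  ⨅ (g : Fin 2 → Plane → ℝ) (_ : ∀ i, HasWeakPartial Ω i v (g i)),
    (eLpNorm v ∞ (volume.restrict Ω) + ∑ i, eLpNorm (g i) ∞ (volume.restrict Ω))

/-- `Δ v ≥ 0` in `Ω` in the sense of distributions. -/
def IsSubharmonicOn (Ω : TopologicalSpace.Opens Plane) (v : Plane → ℝ) : Prop :=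
  LocallyIntegrableOn v Ω ∧
    ∀ φ : 𝓓(Ω, ℝ), (∀ x, 0 ≤ φ x) → 0 ≤ ∫ x in Ω, v x * (Δ (φ : Plane → ℝ)) x

/-- `v ∈ C¹(closure Ω)` with gradient `Dv`: `v` is continuous on the closure, differentiable in `Ω`
with gradient `Dv`, and `Dv` is continuous up to the boundary. -/
def IsC1UpToBoundary (Ω : TopologicalSpace.Opens Plane) (v : Plane → ℝ) (Dv : Plane → Plane) :
    Prop :=
  ContinuousOn v (closure (Ω : Set Plane)) ∧ ContinuousOn Dv (closure (Ω : Set Plane)) ∧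
    ∀ x ∈ Ω, HasGradientAt v (Dv x) x

/-! The function is u = |x|²/2 + N⁻² Σ_m w(Nx - m), with a C² profile w supported in the open unit
square. The scaling N⁻² shrinks values by N⁻² and gradients by N⁻¹ but leaves second derivatives
unchanged. Since the N² copies are disjoint and each carries area N⁻², integrals over the square of
functions of D²w that vanish at 0 do not depend on N. Hence a large N gives closeness to |x|²/2,
while everything about D²u is decided by w. As w and its derivatives vanish off the open square, the
boundary data are exact.

It remains to find w with Δw ≥ -2, with Hessian of L¹ norm at most 1, and with (1 + ∂_ii w)_- large
in Lᵖ (`exists_profile`). The two-dimensional logarithmic potential does this: log(d² + r²) is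
subharmonic, yet each pure second derivative is of order -d⁻² on a disc of radius d, the other one
compensating. The potential is cut off away from the centre, at the cost of a Laplacian bounded
below uniformly in d, and multiplied by d^γ with γ = 1 - 1/p. As d → 0, the cutoff error tends to 0,
and so does the L¹ norm of the Hessian, which before multiplication is at most a constant times
d^(-γ/2). The Lᵖ integral is at least of order d² · d^((γ-2)p) = d^(1-p), which diverges because p >
1. -/

/-! ### Classical derivatives as weak derivatives. -/

theorem ContDiff.partialDeriv {m n : ℕ∞} {f : Plane → ℝ} (hf : ContDiff ℝ n f) (i : Fin 2)
    (hmn : m + 1 ≤ n) : ContDiff ℝ m (partialDeriv i f) :=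
  (hf.fderiv_right (by exact_mod_cast hmn)).clm_apply contDiff_const

theorem tsupport_partialDeriv_subset (i : Fin 2) (f : Plane → ℝ) :
    tsupport (partialDeriv i f) ⊆ tsupport f := by
  refine closure_minimal (fun x hx => ?_) (isClosed_tsupport f)
  refine support_fderiv_subset ℝ (f := f) (fun h => hx ?_)
  simp [partialDeriv, h]

theorem HasCompactSupport.partialDeriv {f : Plane → ℝ} (hf : HasCompactSupport f) (i : Fin 2) :
    HasCompactSupport (partialDeriv i f) :=
  IsCompact.of_isClosed_subset hf (isClosed_tsupport _) (tsupport_partialDeriv_subset i f)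

theorem integral_mul_partialDeriv {f φ : Plane → ℝ} (i : Fin 2) (hf : ContDiff ℝ 1 f)
    (hφ : ContDiff ℝ 1 φ) (hc : HasCompactSupport φ) :
    ∫ x, f x * partialDeriv i φ x = -∫ x, partialDeriv i f x * φ x := by
  have hf' : Continuous (partialDeriv i f) :=
    (hf.partialDeriv (m := 0) (n := 1) i (by simp)).continuous
  have hφ' : Continuous (partialDeriv i φ) :=
    (hφ.partialDeriv (m := 0) (n := 1) i (by simp)).continuous
  refine integral_mul_fderiv_eq_neg_fderiv_mul_of_integrable ?_ ?_ ?_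
    (fun x _ => hf.differentiable one_ne_zero x) (fun x _ => hφ.differentiable one_ne_zero x)
  · exact (hf'.mul hφ.continuous).integrable_of_hasCompactSupport hc.mul_left
  · exact (hf.continuous.mul hφ').integrable_of_hasCompactSupport (hc.partialDeriv i).mul_left
  · exact (hf.continuous.mul hφ.continuous).integrable_of_hasCompactSupport hc.mul_left

theorem setIntegral_mul_eq_integral {Ω : TopologicalSpace.Opens Plane} {ψ : Plane → ℝ}
    (hψ : tsupport ψ ⊆ Ω) (f : Plane → ℝ) :
    ∫ x in Ω, f x * ψ x = ∫ x, f x * ψ x :=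
  setIntegral_eq_integral_of_forall_compl_eq_zero fun x hx => by
    rw [image_eq_zero_of_notMem_tsupport (fun h => hx (hψ h)), mul_zero]

theorem hasWeakPartial_of_contDiff (Ω : TopologicalSpace.Opens Plane) (i : Fin 2) {v : Plane → ℝ}
    (hv : ContDiff ℝ 1 v) : HasWeakPartial Ω i v (partialDeriv i v) := by
  refine ⟨hv.continuous.locallyIntegrable.locallyIntegrableOn _,
    (hv.partialDeriv (m := 0) (n := 1) i (by simp)).continuous.locallyIntegrable.locallyIntegrableOn
      _, fun φ => ?_⟩
  rw [setIntegral_mul_eq_integral φ.tsupport_subset,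
    setIntegral_mul_eq_integral ((tsupport_partialDeriv_subset i φ).trans φ.tsupport_subset),
    integral_mul_partialDeriv i hv (φ.contDiff.of_le (by exact_mod_cast le_top))
      φ.hasCompactSupport]

theorem hasWeakHessian_of_contDiff (Ω : TopologicalSpace.Opens Plane) {v : Plane → ℝ}
    (hv : ContDiff ℝ 2 v) :
    HasWeakHessian Ω v (fun i k => partialDeriv k (partialDeriv i v)) := by
  have hv1 (i : Fin 2) : ContDiff ℝ 1 (partialDeriv i v) :=
    hv.partialDeriv (m := 1) (n := 2) i (by norm_num)
  refine ⟨hv.continuous.locallyIntegrable.locallyIntegrableOn _, fun i k =>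
    ⟨((hv1 i).partialDeriv (m := 0) (n := 1) k
      (by simp)).continuous.locallyIntegrable.locallyIntegrableOn _, fun φ => ?_⟩⟩
  have hφ : ContDiff ℝ 2 φ := contDiff_infty.1 φ.contDiff 2
  have hs := (tsupport_partialDeriv_subset k φ).trans φ.tsupport_subset
  rw [setIntegral_mul_eq_integral φ.tsupport_subset,
    setIntegral_mul_eq_integral ((tsupport_partialDeriv_subset i _).trans hs),
    integral_mul_partialDeriv i (hv.of_le (by norm_num))
      (hφ.partialDeriv (m := 1) (n := 2) k (by norm_num)) (φ.hasCompactSupport.partialDeriv k),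
    integral_mul_partialDeriv k (hv1 i) (hφ.of_le (by norm_num)) φ.hasCompactSupport, neg_neg]

theorem laplacian_eq_sum_partialDeriv {φ : Plane → ℝ} (hφ : ContDiff ℝ 2 φ) (x : Plane) :
    (Δ φ) x = ∑ i, partialDeriv i (partialDeriv i φ) x := by
  rw [InnerProductSpace.laplacian_eq_iteratedFDeriv_orthonormalBasis φ
    (EuclideanSpace.basisFun (Fin 2) ℝ)]
  refine Finset.sum_congr rfl fun i _ => ?_
  have h : DifferentiableAt ℝ (fderiv ℝ φ) x :=
    (hφ.fderiv_right (m := 1) (by norm_num)).differentiable one_ne_zero x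
  have h2 : partialDeriv i φ = fun y => fderiv ℝ φ y (EuclideanSpace.single i 1) := rfl
  rw [h2, partialDeriv, fderiv_clm_apply h (by fun_prop)]
  simp [iteratedFDeriv_two_apply]

theorem isSubharmonicOn_of_contDiff (Ω : TopologicalSpace.Opens Plane) {v : Plane → ℝ}
    (hv : ContDiff ℝ 2 v) (h : ∀ x, 0 ≤ ∑ i, partialDeriv i (partialDeriv i v) x) :
    IsSubharmonicOn Ω v := by
  refine ⟨hv.continuous.locallyIntegrable.locallyIntegrableOn _, fun φ hφ0 => ?_⟩
  have hφ : ContDiff ℝ 2 φ := contDiff_infty.1 φ.contDiff 2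
  have hH := fun i => ((hasWeakHessian_of_contDiff Ω hv).2 i i).2 φ
  have hφ2 (i : Fin 2) : Continuous (partialDeriv i (partialDeriv i φ)) :=
    ((hφ.partialDeriv (m := 1) (n := 2) i (by norm_num)).partialDeriv (m := 0) (n := 1) i
      (by simp)).continuous
  have hv2 (i : Fin 2) : Continuous (partialDeriv i (partialDeriv i v)) :=
    ((hv.partialDeriv (m := 1) (n := 2) i (by norm_num)).partialDeriv (m := 0) (n := 1) i
      (by simp)).continuous
  simp_rw [laplacian_eq_sum_partialDeriv hφ, Finset.mul_sum]
  rw [integral_finsetSum, Finset.sum_congr rfl fun i _ => hH i, ← integral_finsetSum]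
  · refine integral_nonneg fun x => ?_
    simp only [← Finset.sum_mul]
    exact mul_nonneg (h x) (hφ0 x)
  · exact fun i _ => (((hv2 i).mul hφ.continuous).integrable_of_hasCompactSupport
      φ.hasCompactSupport.mul_left).integrableOn
  · exact fun i _ => ((hv.continuous.mul (hφ2 i)).integrable_of_hasCompactSupport
      ((φ.hasCompactSupport.partialDeriv i).partialDeriv i).mul_left).integrableOn

/-! ### Rescaled periodic copies of a profile. -/

/-- The sum of the copies of `f`, rescaled by the factor `N⁻¹`, over the `N²` cells of the regular
subdivision of the unit square. -/
noncomputable def tileSum {α : Type} [AddCommMonoid α] (N : ℕ) (f : Plane → α) (x : Plane) : α :=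
  ∑ m : Fin 2 → Fin N, f ((N : ℝ) • x - WithLp.toLp 2 fun i => (m i : ℝ))

theorem zero_notMem_unitSquare : (0 : Plane) ∉ unitSquare := fun h => by
  simpa using (h 0).1

/-- Pointwise, at most one of the rescaled copies is present. -/
theorem exists_tileSum_eq (N : ℕ) (x : Plane) :
    ∃ y : Plane, (x ∉ unitSquare → y ∉ unitSquare) ∧
      ∀ {α : Type} [AddCommMonoid α] (f : Plane → α), (∀ z ∉ unitSquare, f z = 0) →
        tileSum N f x = f y := by
  by_cases h : ∃ m : Fin 2 → Fin N,
      (N : ℝ) • x - WithLp.toLp 2 (fun i => (m i : ℝ)) ∈ unitSquare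
  · obtain ⟨m, hm⟩ := h
    refine ⟨_, fun hx hm => hx fun i => ?_, fun f hf => Finset.sum_eq_single m (fun m' _ hne => ?_)
      (by simp)⟩
    · have h1 := hm i
      have h2 : ((m i : ℕ) : ℝ) + 1 ≤ N := by exact_mod_cast (m i).2
      have h3 : (0 : ℝ) ≤ (m i : ℕ) := by positivity
      simp only [PiLp.sub_apply, PiLp.smul_apply, smul_eq_mul, mem_Ioo] at h1
      constructor <;> nlinarith
    · refine hf _ fun hm' => hne (funext fun i => Fin.ext ?_)
      have h1 := hm i
      have h2 := hm' i
      simp only [PiLp.sub_apply, PiLp.smul_apply, smul_eq_mul, mem_Ioo] at h1 h2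
      have h3 : ((m' i : ℕ) : ℝ) < (m i : ℕ) + 1 := by linarith
      have h4 : ((m i : ℕ) : ℝ) < (m' i : ℕ) + 1 := by linarith
      norm_cast at h3 h4
      omega
  · push Not at h
    -- When no copy is active, the origin serves as y: it lies outside the open square, so every
    -- admissible f vanishes there.
    exact ⟨0, fun _ => zero_notMem_unitSquare, fun f hf => by
      rw [hf 0 zero_notMem_unitSquare]
      exact Finset.sum_eq_zero fun m _ => hf _ (h m)⟩

/-- At most one summand is nonzero, so even a nonlinear Φ fixing 0 passes through the sum. This is
what handles the power of the negative part. -/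
theorem tileSum_comp {α β : Type} [AddCommMonoid α] [AddCommMonoid β] (N : ℕ) {f : Plane → α}
    (hf : ∀ z ∉ unitSquare, f z = 0) {Φ : α → β} (hΦ : Φ 0 = 0) (x : Plane) :
    Φ (tileSum N f x) = tileSum N (fun y => Φ (f y)) x := by
  obtain ⟨y, -, hy⟩ := exists_tileSum_eq N x
  rw [hy f hf, hy (fun y => Φ (f y)) fun z hz => by rw [hf z hz, hΦ]]

theorem ContDiff.tileSum {n : ℕ∞} (N : ℕ) {f : Plane → ℝ} (hf : ContDiff ℝ n f) :
    ContDiff ℝ n (tileSum N f) :=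
  ContDiff.sum fun m _ => hf.comp (by fun_prop)

theorem partialDeriv_tileSum (N : ℕ) (i : Fin 2) {f : Plane → ℝ} (hf : Differentiable ℝ f) :
    partialDeriv i (tileSum N f) = fun x => N * tileSum N (partialDeriv i f) x := by
  ext x
  have h : HasFDerivAt (tileSum N f) (∑ m : Fin 2 → Fin N,
      (fderiv ℝ f ((N : ℝ) • x - WithLp.toLp 2 fun i => (m i : ℝ))).comp
        ((N : ℝ) • ContinuousLinearMap.id ℝ Plane)) x :=
    HasFDerivAt.fun_sum fun m _ => (hf _).hasFDerivAt.comp x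
      (((hasFDerivAt_id x).const_smul (N : ℝ)).sub_const _)
  rw [partialDeriv, h.fderiv]
  simp [tileSum, partialDeriv, Finset.mul_sum]

theorem lintegral_comp_smul_sub {f : Plane → ℝ≥0∞} (hf : Measurable f) {r : ℝ} (hr : 0 < r)
    (a : Plane) : ∫⁻ x, f (r • x - a) = ENNReal.ofReal ((r ^ 2)⁻¹) * ∫⁻ x, f x := by
  have h1 : Measurable fun y => f (y - a) := by fun_prop
  rw [← lintegral_map (f := fun y => f (y - a)) (g := fun x => r • x) h1 (by fun_prop),
    Measure.map_addHaar_smul _ hr.ne', lintegral_smul_measure, lintegral_sub_right_eq_self f a]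
  simp [abs_of_pos hr]

/-- There are N² copies, and the change of variables gives each one N⁻² times the integral of f. -/
theorem setLIntegral_tileSum {N : ℕ} (hN : 0 < N) {f : Plane → ℝ≥0∞} (hf : Measurable f)
    (h0 : ∀ z ∉ unitSquare, f z = 0) :
    ∫⁻ x in (unitSquare : Set Plane), tileSum N f x = ∫⁻ x, f x := by
  have hs : (unitSquare : Set Plane).indicator (tileSum N f) = tileSum N f := by
    refine indicator_eq_self.2 fun x hx => by_contra fun hx' => hx ?_
    obtain ⟨y, hy, hy'⟩ := exists_tileSum_eq N x
    rw [hy' f h0, h0 y (hy hx')]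
  have hN' : (0 : ℝ) < N := by exact_mod_cast hN
  rw [← lintegral_indicator unitSquare.isOpen.measurableSet, hs]
  unfold tileSum
  rw [lintegral_finsetSum _ fun m _ => by fun_prop]
  simp_rw [lintegral_comp_smul_sub hf hN']
  rw [Finset.sum_const, Finset.card_univ, Fintype.card_fun, Fintype.card_fin, Fintype.card_fin,
    nsmul_eq_mul, ← mul_assoc, ← ENNReal.ofReal_natCast, ← ENNReal.ofReal_mul (by positivity)]
  rw [Nat.cast_pow, mul_inv_cancel₀ (by positivity), ENNReal.ofReal_one, one_mul]

/-! ### Rules for partial derivatives. -/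

theorem partialDeriv_add {f g : Plane → ℝ} (i : Fin 2) (hf : Differentiable ℝ f)
    (hg : Differentiable ℝ g) :
    partialDeriv i (fun x => f x + g x) = fun x => partialDeriv i f x + partialDeriv i g x := by
  ext x
  simp [partialDeriv, fderiv_fun_add (hf x) (hg x)]

theorem partialDeriv_const_mul {f : Plane → ℝ} (i : Fin 2) (c : ℝ) (hf : Differentiable ℝ f) :
    partialDeriv i (fun x => c * f x) = fun x => c * partialDeriv i f x := by
  ext x
  simp [partialDeriv, fderiv_const_mul (hf x)]

theorem partialDeriv_apply_coord (i k : Fin 2) (x : Plane) :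
    partialDeriv k (fun x : Plane => x i) x = if i = k then 1 else 0 := by
  have h : HasFDerivAt (fun x : Plane => x i) (EuclideanSpace.proj i : Plane →L[ℝ] ℝ) x :=
    (EuclideanSpace.proj i : Plane →L[ℝ] ℝ).hasFDerivAt
  rw [partialDeriv, h.fderiv]
  simp

theorem partialDeriv_mul {f g : Plane → ℝ} (i : Fin 2) {x : Plane} (hf : DifferentiableAt ℝ f x)
    (hg : DifferentiableAt ℝ g x) :
    partialDeriv i (fun x => f x * g x) x = partialDeriv i f x * g x + f x * partialDeriv i g x := by
  simp only [partialDeriv, fderiv_fun_mul hf hg, add_apply, smul_apply,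
    smul_eq_mul]
  ring

theorem partialDeriv_comp {f : ℝ → ℝ} {g : Plane → ℝ} (i : Fin 2) {x : Plane}
    (hf : DifferentiableAt ℝ f (g x)) (hg : DifferentiableAt ℝ g x) :
    partialDeriv i (fun x => f (g x)) x = deriv f (g x) * partialDeriv i g x := by
  have h := hf.hasDerivAt.comp_hasFDerivAt x hg.hasFDerivAt
  rw [partialDeriv, partialDeriv, show (fun x => f (g x)) = f ∘ g from rfl, h.fderiv]
  simp

/-! ### The truncated logarithmic potential and its pointwise bounds. -/

/-- A smooth truncation of the function `max z 0`. -/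
theorem exists_smooth_truncation : ∃ (P : ℝ → ℝ) (M : ℝ), ContDiff ℝ 2 P ∧ (∀ z ≤ 0, P z = 0) ∧
    (∀ z > 1, deriv P z = 1 ∧ deriv (deriv P) z = 0) ∧
    ∀ z, |deriv P z| ≤ M ∧ |deriv (deriv P) z| ≤ M := by
  set P : ℝ → ℝ := fun z => z * Real.smoothTransition z with hP
  have hPc : ContDiff ℝ 2 P := contDiff_id.mul (Real.smoothTransition.contDiff (n := 2))
  have hP1 : ContDiff ℝ 1 (deriv P) := hPc.deriv' (n := 1)
  have h0 : ∀ z ≤ 0, P z = 0 := fun z hz => by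
    simp [hP, Real.smoothTransition.zero_of_nonpos hz]
  have hd1 : ∀ z > 1, deriv P z = 1 := fun z hz => by
    have : P =ᶠ[nhds z] id := by
      filter_upwards [lt_mem_nhds hz] with y hy
      simp [hP, Real.smoothTransition.one_of_one_le hy.le]
    rw [this.deriv_eq, deriv_id]
  have hd1' : ∀ z > 1, deriv (deriv P) z = 0 := fun z hz => by
    have : deriv P =ᶠ[nhds z] fun _ => 1 := by
      filter_upwards [lt_mem_nhds hz] with y hy using hd1 y hy
    rw [this.deriv_eq, deriv_const]
  have hd0 : ∀ z < 0, deriv P z = 0 := fun z hz => by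
    have : P =ᶠ[nhds z] fun _ => 0 := by
      filter_upwards [gt_mem_nhds hz] with y hy using h0 y hy.le
    rw [this.deriv_eq, deriv_const]
  have hd0' : ∀ z < 0, deriv (deriv P) z = 0 := fun z hz => by
    have : deriv P =ᶠ[nhds z] fun _ => 0 := by
      filter_upwards [gt_mem_nhds hz] with y hy using hd0 y hy
    rw [this.deriv_eq, deriv_const]
  -- Off [0,1] both derivatives are constant (0 or 1), so only this compact interval needs a bound.
  obtain ⟨M₁, hM₁⟩ := (isCompact_Icc (a := (0 : ℝ)) (b := 1)).exists_bound_of_continuousOn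
    hP1.continuous.continuousOn
  obtain ⟨M₂, hM₂⟩ := (isCompact_Icc (a := (0 : ℝ)) (b := 1)).exists_bound_of_continuousOn
    (hP1.continuous_deriv_one).continuousOn
  refine ⟨P, max 1 (max M₁ M₂), hPc, h0, fun z hz => ⟨hd1 z hz, hd1' z hz⟩, fun z => ?_⟩
  rcases lt_or_ge z 0 with hz | hz
  · simp [hd0 z hz, hd0' z hz]
  · rcases lt_or_ge 1 z with hz' | hz'
    · simp [hd1 z hz', hd1' z hz']
    · exact ⟨(hM₁ z ⟨hz, hz'⟩).trans (by simp), (hM₂ z ⟨hz, hz'⟩).trans (by simp)⟩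

/-- The squared distance to the centre of the unit square, shifted by `d ^ 2`. -/
noncomputable def shiftedSq (d : ℝ) (x : Plane) : ℝ :=
  d ^ 2 + ((x 0 - 1 / 2) ^ 2 + (x 1 - 1 / 2) ^ 2)

/-- A regularized and truncated logarithmic potential. -/
noncomputable def logProfile (P : ℝ → ℝ) (d : ℝ) (x : Plane) : ℝ :=
  -P (-Real.log (16 * shiftedSq d x))

theorem shiftedSq_pos {d : ℝ} (hd : 0 < d) (x : Plane) : 0 < shiftedSq d x := by
  unfold shiftedSq
  positivity

theorem contDiff_shiftedSq (d : ℝ) : ContDiff ℝ 2 (shiftedSq d) := by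
  unfold shiftedSq
  fun_prop

theorem contDiff_neg_log_shiftedSq {d : ℝ} (hd : 0 < d) :
    ContDiff ℝ 2 fun x => -Real.log (16 * shiftedSq d x) :=
  ((contDiff_const.mul (contDiff_shiftedSq d)).log
    fun x => (mul_pos (by norm_num) (shiftedSq_pos hd x)).ne').neg

theorem contDiff_logProfile {P : ℝ → ℝ} (hP : ContDiff ℝ 2 P) {d : ℝ} (hd : 0 < d) :
    ContDiff ℝ 2 (logProfile P d) :=
  (hP.comp (contDiff_neg_log_shiftedSq hd)).neg

theorem partialDeriv_sub_const (i k : Fin 2) (b : ℝ) (x : Plane) :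
    partialDeriv k (fun x : Plane => x i - b) x = if i = k then 1 else 0 := by
  rw [← partialDeriv_apply_coord i k x, partialDeriv, partialDeriv, fderiv_sub_const]

theorem partialDeriv_shiftedSq (d : ℝ) (k : Fin 2) (x : Plane) :
    partialDeriv k (shiftedSq d) x = 2 * (x k - 1 / 2) := by
  have h (i : Fin 2) : HasFDerivAt (fun x : Plane => x i - 1 / 2)
      (EuclideanSpace.proj i : Plane →L[ℝ] ℝ) x :=
    (EuclideanSpace.proj i : Plane →L[ℝ] ℝ).hasFDerivAt.sub_const _
  have := (((h 0).pow 2).add ((h 1).pow 2)).const_add (d ^ 2)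
  have h2 : HasFDerivAt (shiftedSq d) _ x := this
  rw [partialDeriv, h2.fderiv]
  fin_cases k <;> simp

theorem partialDeriv_neg_log_shiftedSq {d : ℝ} (hd : 0 < d) (k : Fin 2) (x : Plane) :
    partialDeriv k (fun x => -Real.log (16 * shiftedSq d x)) x =
      -(2 * (x k - 1 / 2) / shiftedSq d x) := by
  have hs := shiftedSq_pos hd x
  have hf : HasDerivAt (fun t => -Real.log (16 * t)) (-(16 / (16 * shiftedSq d x)))
      (shiftedSq d x) := by
    have h := (((hasDerivAt_id' (shiftedSq d x)).const_mul 16).log (by positivity)).fun_neg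
    simpa only [mul_one] using h
  rw [partialDeriv_comp (f := fun t => -Real.log (16 * t)) k hf.differentiableAt
    ((contDiff_shiftedSq d).differentiable two_ne_zero x), hf.deriv, partialDeriv_shiftedSq]
  field_simp

theorem partialDeriv_logProfile {P : ℝ → ℝ} (hP : ContDiff ℝ 2 P) {d : ℝ} (hd : 0 < d)
    (i : Fin 2) (x : Plane) :
    partialDeriv i (logProfile P d) x =
      deriv P (-Real.log (16 * shiftedSq d x)) * (2 * (x i - 1 / 2) * (shiftedSq d x)⁻¹) := by
  have h := partialDeriv_comp (f := fun z => -P z) (x := x) i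
    (hP.differentiable two_ne_zero _).neg
    ((contDiff_neg_log_shiftedSq hd).differentiable two_ne_zero x)
  rw [partialDeriv_neg_log_shiftedSq hd, deriv.fun_neg] at h
  refine h.trans ?_
  rw [neg_mul_neg, div_eq_mul_inv]

theorem partialDeriv_partialDeriv_logProfile {P : ℝ → ℝ} (hP : ContDiff ℝ 2 P) {d : ℝ}
    (hd : 0 < d) (i k : Fin 2) (x : Plane) :
    partialDeriv k (partialDeriv i (logProfile P d)) x =
      2 * (deriv P (-Real.log (16 * shiftedSq d x)) * (if i = k then 1 else 0) / shiftedSq d x -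
        2 * (deriv P (-Real.log (16 * shiftedSq d x)) +
          deriv (deriv P) (-Real.log (16 * shiftedSq d x))) *
          ((x i - 1 / 2) * (x k - 1 / 2)) / shiftedSq d x ^ 2) := by
  have hs := shiftedSq_pos hd x
  have hP1 : ContDiff ℝ 1 (deriv P) := hP.deriv' (n := 1)
  have hL := (contDiff_neg_log_shiftedSq hd).differentiable two_ne_zero x
  have hsd := (contDiff_shiftedSq d).differentiable two_ne_zero x
  have hinv : DifferentiableAt ℝ (fun x => (shiftedSq d x)⁻¹) x := hsd.fun_inv hs.ne'
  have hy : DifferentiableAt ℝ (fun x : Plane => 2 * (x i - 1 / 2)) x := by fun_prop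
  have hy' : partialDeriv k (fun x : Plane => 2 * (x i - 1 / 2)) x =
      2 * if i = k then 1 else 0 := by
    rw [partialDeriv_const_mul k 2 (by fun_prop)]
    exact congrArg (2 * ·) (partialDeriv_sub_const i k (1 / 2) x)
  rw [show partialDeriv i (logProfile P d) = fun x => _ from
    funext (partialDeriv_logProfile hP hd i)]
  rw [partialDeriv_mul (f := fun x => deriv P (-Real.log (16 * shiftedSq d x)))
      (g := fun x => 2 * (x i - 1 / 2) * (shiftedSq d x)⁻¹) k
      ((hP1.differentiable one_ne_zero _).comp x hL) (hy.fun_mul hinv),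
    partialDeriv_mul k hy hinv, partialDeriv_comp k (hP1.differentiable one_ne_zero _) hL,
    partialDeriv_comp (f := fun t => t⁻¹) k (differentiableAt_inv hs.ne') hsd, deriv_inv,
    partialDeriv_shiftedSq, partialDeriv_neg_log_shiftedSq hd, hy']
  field_simp
  ring

theorem shiftedSq_eq (d : ℝ) (x : Plane) :
    shiftedSq d x = d ^ 2 + ‖x - WithLp.toLp 2 fun _ => 1 / 2‖ ^ 2 := by
  rw [EuclideanSpace.norm_sq_eq, Fin.sum_univ_two, shiftedSq]
  simp

theorem sq_sub_le_shiftedSq (d : ℝ) (i : Fin 2) (x : Plane) :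
    (x i - 1 / 2) ^ 2 ≤ shiftedSq d x := by
  unfold shiftedSq
  fin_cases i <;> simp only [Fin.zero_eta, Fin.mk_one] <;> nlinarith

/-- The factor 16 makes the logarithm nonnegative once the shifted square exceeds 1/16, so the
support lies within distance 1/4 of the centre, for every d. -/
theorem tsupport_logProfile_subset {P : ℝ → ℝ} (h0 : ∀ z ≤ 0, P z = 0) (d : ℝ) :
    tsupport (logProfile P d) ⊆ unitSquare := by
  have hsub : tsupport (logProfile P d) ⊆ {x | shiftedSq d x ≤ 1 / 16} := by
    refine closure_minimal (fun x hx => ?_)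
      (isClosed_le (contDiff_shiftedSq d).continuous continuous_const)
    by_contra hx'
    rw [mem_ofPred_eq, not_le] at hx'
    refine hx ?_
    rw [logProfile, h0 _ (neg_nonpos.2 (Real.log_nonneg (by linarith))), neg_zero]
  refine hsub.trans fun x hx i => ?_
  have h := abs_le_of_sq_le_sq' (((sq_sub_le_shiftedSq d i x).trans hx).trans_eq
    (by norm_num : (1 : ℝ) / 16 = (1 / 4) ^ 2)) (by norm_num)
  constructor <;> linarith [h.1, h.2]

theorem abs_partialDeriv_partialDeriv_logProfile_le {P : ℝ → ℝ} {M : ℝ} (hP : ContDiff ℝ 2 P)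
    (hM : ∀ z, |deriv P z| ≤ M ∧ |deriv (deriv P) z| ≤ M) {d : ℝ} (hd : 0 < d) (i k : Fin 2)
    (x : Plane) :
    |partialDeriv k (partialDeriv i (logProfile P d)) x| ≤ 10 * M / shiftedSq d x := by
  rw [partialDeriv_partialDeriv_logProfile hP hd]
  have hs := shiftedSq_pos hd x
  obtain ⟨h1, h2⟩ := hM (-Real.log (16 * shiftedSq d x))
  set A := deriv P (-Real.log (16 * shiftedSq d x))
  set B := deriv (deriv P) (-Real.log (16 * shiftedSq d x))
  have hM0 : 0 ≤ M := (abs_nonneg _).trans h1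
  have hy : |(x i - 1 / 2) * (x k - 1 / 2)| ≤ shiftedSq d x := by
    have := sq_sub_le_shiftedSq d i x
    have := sq_sub_le_shiftedSq d k x
    rw [abs_le]
    constructor <;> nlinarith [sq_nonneg ((x i - 1 / 2) - (x k - 1 / 2)),
      sq_nonneg ((x i - 1 / 2) + (x k - 1 / 2))]
  have e1 : |A * (if i = k then 1 else 0) / shiftedSq d x| ≤ M / shiftedSq d x := by
    rw [abs_div, abs_of_pos hs]
    gcongr
    split_ifs <;> simpa
  have e2 : |2 * (A + B) * ((x i - 1 / 2) * (x k - 1 / 2)) / shiftedSq d x ^ 2| ≤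
      4 * M / shiftedSq d x := by
    rw [abs_div, abs_mul, abs_of_pos (pow_pos hs 2), div_le_div_iff₀ (pow_pos hs 2) hs]
    have h3 : |2 * (A + B)| ≤ 4 * M := by
      rw [abs_mul, abs_two]
      linarith [abs_add_le A B]
    calc _ ≤ 4 * M * shiftedSq d x * shiftedSq d x := by gcongr
      _ = _ := by ring
  calc _ = 2 * |A * (if i = k then 1 else 0) / shiftedSq d x -
        2 * (A + B) * ((x i - 1 / 2) * (x k - 1 / 2)) / shiftedSq d x ^ 2| := by
        rw [abs_mul, abs_two]
    _ ≤ 2 * (M / shiftedSq d x + 4 * M / shiftedSq d x) := by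
        gcongr
        exact (abs_sub _ _).trans (add_le_add e1 e2)
    _ = _ := by ring

/-- Since 48 = 16 · 3 and e < 3, the hypothesis gives 16 s < 1/3 < 1/e; below this threshold the
truncation is inactive. -/
theorem one_lt_neg_log {s : ℝ} (hs : 0 < s) (h : s < 1 / 48) : 1 < -Real.log (16 * s) := by
  rw [lt_neg, Real.log_lt_iff_lt_exp (by positivity), Real.exp_neg]
  have : (1 / 3 : ℝ) < (Real.exp 1)⁻¹ := by
    rw [one_div]
    exact inv_strictAnti₀ (Real.exp_pos 1) (Real.exp_one_lt_d9.trans (by norm_num))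
  linarith

/-- Write s for the shifted square. Where s < 1/48, the profile has the derivatives of log s, whose
Laplacian 4d²/s² is nonnegative. Elsewhere each pure second derivative is at most 10M/s ≤ 480M in
absolute value. The bound does not depend on d. -/
theorem neg_le_laplacian_logProfile {P : ℝ → ℝ} {M : ℝ} (hP : ContDiff ℝ 2 P)
    (h1 : ∀ z > 1, deriv P z = 1 ∧ deriv (deriv P) z = 0)
    (hM : ∀ z, |deriv P z| ≤ M ∧ |deriv (deriv P) z| ≤ M) {d : ℝ} (hd : 0 < d) (x : Plane) :
    -(960 * M) ≤ ∑ i, partialDeriv i (partialDeriv i (logProfile P d)) x := by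
  have hs := shiftedSq_pos hd x
  have hM0 : 0 ≤ M := (abs_nonneg _).trans (hM 0).1
  rcases lt_or_ge (shiftedSq d x) (1 / 48) with h | h
  · obtain ⟨h2, h3⟩ := h1 _ (one_lt_neg_log hs h)
    simp_rw [partialDeriv_partialDeriv_logProfile hP hd, h2, h3]
    rw [Fin.sum_univ_two]
    have e : 2 * (1 * 1 / shiftedSq d x -
        2 * (1 + 0) * ((x 0 - 1 / 2) * (x 0 - 1 / 2)) / shiftedSq d x ^ 2) +
        2 * (1 * 1 / shiftedSq d x -
        2 * (1 + 0) * ((x 1 - 1 / 2) * (x 1 - 1 / 2)) / shiftedSq d x ^ 2) =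
        4 * d ^ 2 / shiftedSq d x ^ 2 := by
      field_simp
      rw [shiftedSq]
      ring
    simp only [if_true]
    rw [e]
    exact (neg_nonpos.2 (by positivity)).trans (by positivity)
  · have hb (i : Fin 2) : -(480 * M) ≤ partialDeriv i (partialDeriv i (logProfile P d)) x := by
      refine (neg_le_neg ?_).trans
        (neg_le_of_abs_le (abs_partialDeriv_partialDeriv_logProfile_le hP hM hd i i x))
      rw [div_le_iff₀ hs]
      nlinarith
    rw [Fin.sum_univ_two]
    linarith [hb 0, hb 1]

/-- With y the offset from the centre, z its other coordinate and s = d² + |y|², the derivative is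
2(s - 2y_i²)/s². On this ball 2d ≤ y_i ≤ 4d and |z| ≤ d, so s ≤ 18d² and s - 2y_i² = d² + z² - y_i²
≤ -2d². The quotient is then at most -4d²/(18d²)² = -1/(81d²). -/
theorem partialDeriv_partialDeriv_logProfile_le {P : ℝ → ℝ} (hP : ContDiff ℝ 2 P)
    (h1 : ∀ z > 1, deriv P z = 1 ∧ deriv (deriv P) z = 0) {d : ℝ} (hd : 0 < d)
    (hd' : 18 * d ^ 2 < 1 / 48) (i : Fin 2) {x : Plane}
    (hx : x ∈ Metric.ball ((WithLp.toLp 2 fun _ => 1 / 2) + EuclideanSpace.single i (3 * d)) d) :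
    partialDeriv i (partialDeriv i (logProfile P d)) x ≤ -(1 / (81 * d ^ 2)) := by
  have hs := shiftedSq_pos hd x
  rw [mem_ball_iff_norm] at hx
  replace hx := pow_lt_pow_left₀ hx (norm_nonneg _) two_ne_zero
  rw [EuclideanSpace.norm_sq_eq, Fin.sum_univ_two] at hx
  have key : shiftedSq d x ≤ 18 * d ^ 2 ∧
      shiftedSq d x - 2 * (x i - 1 / 2) ^ 2 ≤ -(2 * d ^ 2) := by
    have aux (y z : ℝ) (h : (y - 3 * d) ^ 2 + z ^ 2 < d ^ 2) :
        2 * d ≤ y ∧ y ≤ 4 * d ∧ z ^ 2 ≤ d ^ 2 := by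
      have := abs_le_of_sq_le_sq' (a := y - 3 * d) (b := d) (by nlinarith) hd.le
      exact ⟨by linarith, by linarith, by nlinarith⟩
    unfold shiftedSq
    obtain rfl | rfl : i = 0 ∨ i = 1 := by omega
    · obtain ⟨h2, h3, h4⟩ := aux (x 0 - 1 / 2) (x 1 - 1 / 2) (by
        simpa [sub_sub] using hx)
      constructor <;> nlinarith
    · obtain ⟨h2, h3, h4⟩ := aux (x 1 - 1 / 2) (x 0 - 1 / 2) (by
        rw [add_comm]
        simpa [sub_sub] using hx)
      constructor <;> nlinarith
  obtain ⟨h2, h3⟩ := h1 _ (one_lt_neg_log hs (key.1.trans_lt hd'))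
  rw [partialDeriv_partialDeriv_logProfile hP hd, h2, h3, if_pos rfl]
  have e : 2 * (1 * 1 / shiftedSq d x - 2 * (1 + 0) * ((x i - 1 / 2) * (x i - 1 / 2)) /
      shiftedSq d x ^ 2) = -(2 * -(shiftedSq d x - 2 * (x i - 1 / 2) ^ 2) / shiftedSq d x ^ 2) := by
    field_simp
    ring
  rw [e, neg_le_neg_iff, div_le_div_iff₀ (by positivity) (by positivity)]
  have h4 : shiftedSq d x ^ 2 ≤ (18 * d ^ 2) ^ 2 := pow_le_pow_left₀ hs.le key.1 2
  nlinarith [mul_le_mul_of_nonneg_right key.2 (by positivity : 0 ≤ 81 * d ^ 2)]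

/-! ### Integral estimates for the Hessian of the potential. -/

theorem lintegral_ball_norm_rpow_lt_top {e : ℝ} (he : 0 < e) :
    ∫⁻ x in Metric.ball (0 : Plane) 1, ENNReal.ofReal (‖x‖ ^ (e - 2)) < ∞ := by
  have h : IntegrableOn (fun x : Plane => ‖x‖ ^ (e - 2)) (Metric.ball 0 1) := by
    rw [integrableOn_fun_norm_addHaar volume (f := fun r : ℝ => r ^ (e - 2))]
    have h1 : IntegrableOn (fun y : ℝ => y ^ (e - 1)) (Ioo 0 1) :=
      (intervalIntegral.integrableOn_Ioo_rpow_iff one_pos).2 (by linarith)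
    refine h1.congr_fun (fun y hy => ?_) measurableSet_Ioo
    simp only [finrank_euclideanSpace, Fintype.card_fin, smul_eq_mul]
    rw [show e - 1 = 1 + (e - 2) by ring, Real.rpow_add hy.1, Real.rpow_one]
    norm_num
  exact h.lintegral_lt_top

/-- Interpolation between the two lower bounds d and |x - a| for √s, where s is the shifted square
and a the centre: s⁻¹ = √s^(-e) · √s^(e-2). A small power of d is sacrificed to make the singularity
integrable in the plane. -/
theorem inv_shiftedSq_le {d e : ℝ} (hd : 0 < d) (he : 0 < e) (he2 : e < 2) {x : Plane}
    (hx : x ≠ WithLp.toLp 2 fun _ => 1 / 2) :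
    (shiftedSq d x)⁻¹ ≤ d ^ (-e) * ‖x - WithLp.toLp 2 fun _ => 1 / 2‖ ^ (e - 2) := by
  have hs := shiftedSq_pos hd x
  have hn : 0 < ‖x - WithLp.toLp 2 fun _ => (1 / 2 : ℝ)‖ := norm_pos_iff.2 (sub_ne_zero.2 hx)
  have h1 : d ≤ √(shiftedSq d x) := Real.le_sqrt_of_sq_le (by rw [shiftedSq]; nlinarith)
  have h2 : ‖x - WithLp.toLp 2 fun _ => (1 / 2 : ℝ)‖ ≤ √(shiftedSq d x) :=
    Real.le_sqrt_of_sq_le (by rw [shiftedSq_eq]; nlinarith)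
  calc (shiftedSq d x)⁻¹ = √(shiftedSq d x) ^ (-e) * √(shiftedSq d x) ^ (e - 2) := by
        rw [← Real.rpow_add (Real.sqrt_pos.2 hs), show -e + (e - 2) = -((2 : ℕ) : ℝ) by push_cast; ring,
          Real.rpow_neg (Real.sqrt_nonneg _), Real.rpow_natCast, Real.sq_sqrt hs.le]
    _ ≤ _ := mul_le_mul (Real.rpow_le_rpow_of_nonpos hd h1 (by linarith))
        (Real.rpow_le_rpow_of_nonpos hn h2 (by linarith)) (by positivity) (by positivity)

theorem lintegral_hessian_logProfile_le {P : ℝ → ℝ} {M : ℝ} (hP : ContDiff ℝ 2 P)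
    (h0 : ∀ z ≤ 0, P z = 0) (hM : ∀ z, |deriv P z| ≤ M ∧ |deriv (deriv P) z| ≤ M) {d e : ℝ}
    (hd : 0 < d) (he : 0 < e) (he2 : e < 2) :
    ∫⁻ x, ∑ i, ∑ k, ENNReal.ofReal |partialDeriv k (partialDeriv i (logProfile P d)) x| ≤
      ENNReal.ofReal (40 * M * d ^ (-e)) *
        ∫⁻ x in Metric.ball (0 : Plane) 1, ENNReal.ofReal (‖x‖ ^ (e - 2)) := by
  have hM0 : 0 ≤ M := (abs_nonneg _).trans (hM 0).1
  set a : Plane := WithLp.toLp 2 fun _ => 1 / 2 with ha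
  rw [← lintegral_indicator measurableSet_ball, ← lintegral_sub_right_eq_self (Set.indicator _ _) a,
    ← lintegral_const_mul' _ _ ENNReal.ofReal_ne_top]
  refine lintegral_mono_ae ?_
  filter_upwards [compl_mem_ae_iff.2 (measure_singleton a)] with x hx
  by_cases hxb : x - a ∈ Metric.ball (0 : Plane) 1
  · rw [indicator_of_mem hxb, ← ENNReal.ofReal_mul (by positivity)]
    have hb (i k : Fin 2) :
        ENNReal.ofReal |partialDeriv k (partialDeriv i (logProfile P d)) x| ≤
          ENNReal.ofReal (10 * M * (d ^ (-e) * ‖x - a‖ ^ (e - 2))) := by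
      refine ENNReal.ofReal_le_ofReal
        ((abs_partialDeriv_partialDeriv_logProfile_le hP hM hd i k x).trans ?_)
      rw [div_eq_mul_inv]
      exact mul_le_mul_of_nonneg_left (inv_shiftedSq_le hd he he2 hx) (by positivity)
    refine (Finset.sum_le_sum fun i _ => Finset.sum_le_sum fun k _ => hb i k).trans_eq ?_
    rw [Finset.sum_const, Finset.sum_const, Finset.card_univ, Fintype.card_fin, smul_smul,
      ← ENNReal.ofReal_nsmul]
    congr 1
    simp only [nsmul_eq_mul]
    push_cast
    ring
  -- The support lies in the unit square, which is contained in the unit ball about its centre.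
  · have hz (i k : Fin 2) : partialDeriv k (partialDeriv i (logProfile P d)) x = 0 := by
      refine image_eq_zero_of_notMem_tsupport fun h => hxb ?_
      have h' := tsupport_logProfile_subset h0 d
        (tsupport_partialDeriv_subset i _ (tsupport_partialDeriv_subset k _ h))
      have h2 := h' 0
      have h3 := h' 1
      rw [mem_ball_zero_iff, EuclideanSpace.norm_eq, Real.sqrt_lt' one_pos, Fin.sum_univ_two]
      simp only [Real.norm_eq_abs, sq_abs, ha, PiLp.sub_apply]
      nlinarith [h2.1, h2.2, h3.1, h3.2]
    simp [hz]

/-- Only the ball where ∂_ii is very negative is kept. There the negative part is at least c/(81d²)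
- 1, and c/d² ≥ 162 lets half of the first term absorb the 1. -/
theorem le_lintegral_logProfile {P : ℝ → ℝ} (hP : ContDiff ℝ 2 P)
    (h1 : ∀ z > 1, deriv P z = 1 ∧ deriv (deriv P) z = 0) {p c d : ℝ} (hp : 0 ≤ p) (hc : 0 ≤ c)
    (hd : 0 < d) (hd' : 18 * d ^ 2 < 1 / 48) (hcd : 162 ≤ c / d ^ 2) (i : Fin 2) :
    ENNReal.ofReal (Real.pi * d ^ 2 * (c / d ^ 2 / 162) ^ p) ≤
      ∫⁻ x, ENNReal.ofReal
        (max (-(1 + c * partialDeriv i (partialDeriv i (logProfile P d)) x)) 0 ^ p) := by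
  set B := Metric.ball ((WithLp.toLp 2 fun _ => 1 / 2) + EuclideanSpace.single i (3 * d) : Plane) d
  have hB : volume B = ENNReal.ofReal (Real.pi * d ^ 2) := by
    rw [EuclideanSpace.volume_ball_fin_two, ENNReal.ofReal_mul Real.pi_pos.le,
      ENNReal.ofReal_pow hd.le, mul_comm]
  calc _ = ∫⁻ _ in B, ENNReal.ofReal ((c / d ^ 2 / 162) ^ p) := by
        rw [setLIntegral_const, hB, ENNReal.ofReal_mul (by positivity), mul_comm]
    _ ≤ _ := setLIntegral_mono' Metric.isOpen_ball.measurableSet fun x hx => ?_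
    _ ≤ _ := setLIntegral_le_lintegral B _
  refine ENNReal.ofReal_le_ofReal (Real.rpow_le_rpow (by positivity) (le_max_of_le_left ?_) hp)
  have h := mul_le_mul_of_nonneg_left
    (partialDeriv_partialDeriv_logProfile_le hP h1 hd hd' i hx) hc
  have e : c * -(1 / (81 * d ^ 2)) = -(c / d ^ 2 / 81) := by
    field_simp
  rw [e] at h
  linarith

/-! ### Choice of the concentration scale d. -/

open Filter Topology in
/-- For every `p > 1` there is a compactly supported function in the unit square whose Laplacian is
at least `-2`, whose Hessian is small in `L¹`, and for which the negative parts of the pure second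
derivatives of `‖x‖ ^ 2 / 2 + w x` are large in `Lᵖ`. -/
theorem exists_profile {p : ℝ} (hp : 1 < p) (J : ℕ) :
    ∃ w : Plane → ℝ, ContDiff ℝ 2 w ∧ tsupport w ⊆ unitSquare ∧
      (∀ x, -2 ≤ ∑ i, partialDeriv i (partialDeriv i w) x) ∧
      (∫⁻ x, ∑ i, ∑ k, ENNReal.ofReal |partialDeriv k (partialDeriv i w) x| ≤ 1) ∧
      ∀ i, (J : ℝ≥0∞) ≤
        ∫⁻ x, ENNReal.ofReal (max (-(1 + partialDeriv i (partialDeriv i w) x)) 0 ^ p) := by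
  obtain ⟨P, M, hP, h0, h1, hM⟩ := exists_smooth_truncation
  have hM0 : 0 ≤ M := (abs_nonneg _).trans (hM 0).1
  have hp0 : 0 < p := by linarith
  -- This exponent gives 2 + (γ - 2)p = 1 - p < 0, while γ > 0 keeps the other quantities small.
  set γ : ℝ := 1 - 1 / p with hγ
  have hγ0 : 0 < γ := sub_pos.2 ((div_lt_one hp0).2 hp)
  have hγ1 : γ < 1 := sub_lt_self _ (by positivity)
  set K := ∫⁻ x in Metric.ball (0 : Plane) 1, ENNReal.ofReal (‖x‖ ^ (γ / 2 - 2))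
  have hK : K < ∞ := lintegral_ball_norm_rpow_lt_top (by positivity)
  have hlim {b : ℝ} (hb : 0 < b) (A : ℝ) : Tendsto (fun d : ℝ => A * d ^ b) (𝓝[>] 0) (𝓝 0) := by
    have h := (Real.continuousAt_rpow_const 0 b (Or.inr hb.le)).tendsto.const_mul A
    rw [Real.zero_rpow hb.ne', mul_zero] at h
    exact h.mono_left nhdsWithin_le_nhds
  -- In turn: the cutoff error in the Laplacian is at most 2; the L¹ norm of the Hessian is at most
  -- 1, using e = γ/2 so that d^γ · d^(-e) = d^(γ/2); the test ball lies where the truncation is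
  -- inactive; the constant 1 is absorbed; the Lᵖ integral reaches J.
  have E1 := (hlim hγ0 (960 * M)).eventually_le_const (two_pos (α := ℝ))
  have E2 := (hlim (half_pos hγ0) (40 * M * K.toReal)).eventually_le_const (one_pos (α := ℝ))
  have E3 := (hlim two_pos 18).eventually_lt_const (by norm_num : (0 : ℝ) < 1 / 48)
  have E4 := (tendsto_rpow_neg_nhdsGT_zero (by linarith : γ - 2 < 0)).eventually_ge_atTop 162
  have E5 := ((tendsto_rpow_neg_nhdsGT_zero (by linarith : 1 - p < 0)).const_mul_atTop
    (by positivity : 0 < Real.pi * ((162 : ℝ) ^ p)⁻¹)).eventually_ge_atTop (J : ℝ)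
  obtain ⟨d, h2, h3, h4, h5, h6, hd⟩ := (E1.and (E2.and (E3.and (E4.and (E5.and
    (self_mem_nhdsWithin : Ioi (0 : ℝ) ∈ 𝓝[>] 0)))))).exists
  rw [Real.rpow_two] at h4
  have hG := contDiff_logProfile hP hd
  have hG2 (i k : Fin 2) : partialDeriv k (partialDeriv i (fun x => d ^ γ * logProfile P d x)) =
      fun x => d ^ γ * partialDeriv k (partialDeriv i (logProfile P d)) x := by
    rw [partialDeriv_const_mul i _ (hG.differentiable two_ne_zero), partialDeriv_const_mul k _
      ((hG.partialDeriv (m := 1) (n := 2) i (by norm_num)).differentiable one_ne_zero)]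
  have hdγ : d ^ γ / d ^ 2 = d ^ (γ - 2) := by rw [Real.rpow_sub hd γ 2, Real.rpow_two]
  refine ⟨fun x => d ^ γ * logProfile P d x, contDiff_const.mul hG,
    (tsupport_mul_subset_right (f := fun _ => d ^ γ)).trans (tsupport_logProfile_subset h0 d),
    fun x => ?_, ?_, fun i => ?_⟩
  · simp_rw [hG2, ← Finset.mul_sum]
    have := mul_le_mul_of_nonneg_left (neg_le_laplacian_logProfile hP h1 hM hd x)
      (Real.rpow_nonneg hd.le γ)
    linarith
  · simp_rw [hG2, abs_mul, abs_of_pos (Real.rpow_pos_of_pos hd γ),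
      ENNReal.ofReal_mul (Real.rpow_nonneg hd.le γ), ← Finset.mul_sum]
    rw [lintegral_const_mul' _ _ ENNReal.ofReal_ne_top]
    refine (mul_le_mul_right (lintegral_hessian_logProfile_le hP h0 hM hd (half_pos hγ0)
      (by linarith)) _).trans ?_
    change _ * (_ * K) ≤ 1
    rw [← ENNReal.ofReal_toReal hK.ne, ← ENNReal.ofReal_mul (by positivity),
      ← ENNReal.ofReal_mul (by positivity), ENNReal.ofReal_le_one]
    refine le_of_eq_of_le ?_ h3
    rw [show d ^ (γ / 2) = d ^ γ * d ^ (-(γ / 2)) by rw [← Real.rpow_add hd]; ring_nf]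
    ring
  · simp_rw [hG2]
    refine le_trans ?_ (le_lintegral_logProfile hP h1 hp0.le (Real.rpow_nonneg hd.le γ) hd h4
      (hdγ ▸ h5) i)
    rw [← ENNReal.ofReal_natCast, hdγ]
    refine ENNReal.ofReal_le_ofReal (h6.trans_eq ?_)
    rw [Real.div_rpow (by positivity) (by norm_num), ← Real.rpow_mul hd.le,
      show 1 - p = 2 + (γ - 2) * p by rw [hγ]; field_simp; ring, Real.rpow_add hd, Real.rpow_two]
    ring

/-! ### Assembly of the solution. -/

theorem unitSquare_subset_ball : (unitSquare : Set Plane) ⊆ Metric.ball 0 2 := fun x hx => by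
  have h0 := hx 0
  have h1 := hx 1
  rw [mem_ball_zero_iff, EuclideanSpace.norm_eq, Real.sqrt_lt' two_pos, Fin.sum_univ_two]
  simp only [Real.norm_eq_abs, sq_abs]
  nlinarith [h0.1, h0.2, h1.1, h1.2]

theorem contDiff_norm_sq_div_two : ContDiff ℝ 2 fun x : Plane => ‖x‖ ^ 2 / 2 :=
  (contDiff_norm_sq ℝ).div_const 2

theorem partialDeriv_norm_sq_div_two (i : Fin 2) :
    partialDeriv i (fun x : Plane => ‖x‖ ^ 2 / 2) = fun x => x i := by
  ext x
  have h : HasFDerivAt (fun x : Plane => ‖x‖ ^ 2 / 2) (innerSL ℝ x) x := by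
    have h := (hasStrictFDerivAt_norm_sq x).hasFDerivAt.mul_const (2⁻¹ : ℝ)
    rw [← Nat.cast_smul_eq_nsmul ℝ, smul_smul] at h
    simpa [div_eq_mul_inv] using h
  rw [partialDeriv, h.fderiv, innerSL_apply_apply, EuclideanSpace.inner_single_right]
  simp

theorem gradient_apply_eq_partialDeriv {f : Plane → ℝ} (x : Plane) (i : Fin 2) :
    gradient f x i = partialDeriv i f x := by
  rw [partialDeriv, ← InnerProductSpace.toDual_symm_apply (𝕜 := ℝ), EuclideanSpace.inner_single_right]
  simp [gradient]

theorem continuous_gradient {f : Plane → ℝ} (hf : ContDiff ℝ 1 f) : Continuous (gradient f) :=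
  (InnerProductSpace.toDual ℝ Plane).symm.continuous.comp (hf.continuous_fderiv one_ne_zero)

theorem w1InftyNorm_le {Ω : TopologicalSpace.Opens Plane} {v : Plane → ℝ} (hv : ContDiff ℝ 1 v)
    {K : ℝ} (h : ∀ x, |v x| ≤ K) (h' : ∀ i x, |partialDeriv i v x| ≤ K) :
    w1InftyNorm Ω v ≤ ENNReal.ofReal (3 * K) := by
  have hK : 0 ≤ K := (abs_nonneg _).trans (h 0)
  refine (iInf₂_le (fun i => partialDeriv i v) fun i => hasWeakPartial_of_contDiff Ω i hv).trans ?_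
  have hb {f : Plane → ℝ} (hf : ∀ x, |f x| ≤ K) :
      eLpNorm f ∞ (volume.restrict (Ω : Set Plane)) ≤ ENNReal.ofReal K := by
    rw [eLpNorm_exponent_top]
    exact eLpNormEssSup_le_of_ae_bound (Filter.Eventually.of_forall hf)
  rw [Fin.sum_univ_two]
  refine (add_le_add (hb h) (add_le_add (hb (h' 0)) (hb (h' 1)))).trans ?_
  rw [← ENNReal.ofReal_add hK hK, ← ENNReal.ofReal_add hK (by positivity)]
  exact ENNReal.ofReal_le_ofReal (by linarith)

theorem theorem3p6 :
    ∃ C : ℝ, 0 < C ∧ ∀ (p : ℝ) (j : ℕ), 1 < p → 1 ≤ j →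
      ∃ (u : Plane → ℝ) (Du : Plane → Plane) (H : Fin 2 → Fin 2 → Plane → ℝ),
        IsC1UpToBoundary unitSquare u Du ∧
        (∀ x ∈ frontier (unitSquare : Set Plane), u x = ‖x‖ ^ 2 / 2 ∧ Du x = x) ∧
        w1InftyNorm unitSquare (fun x => u x - ‖x‖ ^ 2 / 2) ≤ ENNReal.ofReal (1 / (j : ℝ)) ∧
        IsSubharmonicOn unitSquare u ∧
        HasWeakHessian unitSquare u H ∧
        (∫⁻ x in (unitSquare : Set Plane), ∑ i, ∑ k, ENNReal.ofReal |H i k x|)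
          ≤ ENNReal.ofReal C ∧
        ∀ i, (j : ℝ≥0∞) ≤
          ∫⁻ x in (unitSquare : Set Plane), ENNReal.ofReal (max (-(H i i x)) 0 ^ p) := by
  -- The Hessian of |x|²/2 contributes 2 times the area of the square, bounded crudely by that of a
  -- disc of radius 2; the profile contributes at most 1.
  refine ⟨2 * (Real.pi * 4) + 1, by positivity, fun p j hp hj => ?_⟩
  obtain ⟨w, hw, hws, hwΔ, hw1, hwp⟩ := exists_profile hp j
  have hwc : HasCompactSupport w := Metric.isCompact_of_isClosed_isBounded (isClosed_tsupport w)
    (Metric.isBounded_ball.subset (hws.trans unitSquare_subset_ball))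
  have hw' (i : Fin 2) : ContDiff ℝ 1 (partialDeriv i w) :=
    hw.partialDeriv (m := 1) (n := 2) i (by norm_num)
  have hw'' (i k : Fin 2) : Continuous (partialDeriv k (partialDeriv i w)) :=
    ((hw' i).partialDeriv (m := 0) (n := 1) k (by simp)).continuous
  have hz : ∀ z ∉ unitSquare, w z = 0 := fun z hz =>
    image_eq_zero_of_notMem_tsupport fun h => hz (hws h)
  have hz' : ∀ i, ∀ z ∉ unitSquare, partialDeriv i w z = 0 := fun i z hz =>
    image_eq_zero_of_notMem_tsupport fun h => hz (hws (tsupport_partialDeriv_subset i w h))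
  have hz'' : ∀ i k, ∀ z ∉ unitSquare, partialDeriv k (partialDeriv i w) z = 0 :=
    fun i k z hz => image_eq_zero_of_notMem_tsupport fun h => hz (hws
      (tsupport_partialDeriv_subset i w (tsupport_partialDeriv_subset k _ h)))
  obtain ⟨K₀, hK₀⟩ := hw.continuous.bounded_above_of_compact_support hwc
  choose K₁ hK₁ using fun i =>
    (hw' i).continuous.bounded_above_of_compact_support (hwc.partialDeriv i)
  obtain ⟨K, hK0, hKw, hKd⟩ : ∃ K : ℝ, 0 ≤ K ∧ (∀ x, |w x| ≤ K) ∧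
      ∀ i x, |partialDeriv i w x| ≤ K := by
    refine ⟨max K₀ (max (K₁ 0) (K₁ 1)), ((norm_nonneg _).trans (hK₀ 0)).trans (le_max_left _ _),
      fun x => (hK₀ x).trans (le_max_left _ _), fun i x => (hK₁ i x).trans ?_⟩
    fin_cases i <;> simp
  -- The W^{1,∞} norm is at most 3K/N, one K/N for the value and one for each partial derivative;
  -- the extra 1 keeps N positive.
  obtain ⟨N, hN⟩ := exists_nat_ge (3 * K * j + 1)
  have hj' : (1 : ℝ) ≤ j := by exact_mod_cast hj
  have hN1 : (1 : ℝ) ≤ N := le_trans (by nlinarith [mul_nonneg hK0 (zero_le_one.trans hj')]) hN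
  have hN0 : (0 : ℝ) < N := by linarith
  set v : Plane → ℝ := fun x => ((N : ℝ) ^ 2)⁻¹ * tileSum N w x with hv
  have hvc : ContDiff ℝ 2 v := contDiff_const.mul (hw.tileSum (n := 2) N)
  have hv1 (i : Fin 2) : partialDeriv i v = fun x => (N : ℝ)⁻¹ * tileSum N (partialDeriv i w) x := by
    rw [hv, partialDeriv_const_mul i _ ((hw.tileSum (n := 2) N).differentiable two_ne_zero),
      partialDeriv_tileSum N i (hw.differentiable two_ne_zero)]
    ext x
    field_simp
  have hv2 (i k : Fin 2) : partialDeriv k (partialDeriv i v) =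
      tileSum N (partialDeriv k (partialDeriv i w)) := by
    rw [hv1, partialDeriv_const_mul k _ (((hw' i).tileSum (n := 1) N).differentiable one_ne_zero),
      partialDeriv_tileSum N k ((hw' i).differentiable one_ne_zero)]
    ext x
    field_simp
  have hvb (x : Plane) : |v x| ≤ K / N := by
    obtain ⟨y, -, hy⟩ := exists_tileSum_eq N x
    simp only [hv]
    rw [hy w hz, abs_mul, abs_of_pos (by positivity), div_eq_inv_mul]
    refine mul_le_mul ?_ (hKw y) (abs_nonneg _) (by positivity)
    exact inv_anti₀ hN0 (by nlinarith)
  have hvb' (i : Fin 2) (x : Plane) : |partialDeriv i v x| ≤ K / N := by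
    obtain ⟨y, -, hy⟩ := exists_tileSum_eq N x
    rw [hv1]
    simp only
    rw [hy _ (hz' i), abs_mul, abs_of_pos (by positivity), div_eq_inv_mul]
    exact mul_le_mul_of_nonneg_left (hKd i y) (by positivity)
  set u : Plane → ℝ := fun x => ‖x‖ ^ 2 / 2 + v x with hu
  have huc : ContDiff ℝ 2 u := contDiff_norm_sq_div_two.add hvc
  have hu1 (i : Fin 2) : partialDeriv i u = fun x => x i + partialDeriv i v x := by
    rw [hu, partialDeriv_add i (contDiff_norm_sq_div_two.differentiable two_ne_zero)
      (hvc.differentiable two_ne_zero), partialDeriv_norm_sq_div_two]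
  have hu2 (i k : Fin 2) (x : Plane) : partialDeriv k (partialDeriv i u) x =
      (if i = k then 1 else 0) + tileSum N (partialDeriv k (partialDeriv i w)) x := by
    rw [hu1, partialDeriv_add k (by fun_prop)
      ((hvc.partialDeriv (m := 1) (n := 2) i (by norm_num)).differentiable one_ne_zero), hv2]
    exact congrArg (· + _) (partialDeriv_apply_coord i k x)
  refine ⟨u, gradient u, fun i k => partialDeriv k (partialDeriv i u),
    ⟨huc.continuous.continuousOn, (continuous_gradient (huc.of_le (by norm_num))).continuousOn,
      fun x _ => (huc.differentiable two_ne_zero x).hasGradientAt⟩, fun x hx => ?_, ?_,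
    isSubharmonicOn_of_contDiff _ huc fun x => ?_, hasWeakHessian_of_contDiff _ huc, ?_,
    fun i => ?_⟩
  · have hx' : x ∉ unitSquare := (unitSquare.isOpen.frontier_eq ▸ hx).2
    obtain ⟨y, hy', hy⟩ := exists_tileSum_eq N x
    refine ⟨by simp [hu, hv, hy w hz, hz y (hy' hx')], PiLp.ext fun i => ?_⟩
    rw [gradient_apply_eq_partialDeriv, hu1, hv1]
    simp [hy _ (hz' i), hz' i y (hy' hx')]
  · have : (fun x => u x - ‖x‖ ^ 2 / 2) = v := by ext x; simp [hu]
    rw [this]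
    refine (w1InftyNorm_le (hvc.of_le (by norm_num)) hvb hvb').trans (ENNReal.ofReal_le_ofReal ?_)
    rw [← mul_div_assoc, div_le_div_iff₀ hN0 (by linarith)]
    linarith
  -- The Laplacian of |x|²/2 is 2, which exactly offsets Δw ≥ -2.
  · obtain ⟨y, -, hy⟩ := exists_tileSum_eq N x
    have := hwΔ y
    simp only [hu2, hy _ (hz'' _ _), Fin.sum_univ_two, if_true] at this ⊢
    linarith
  · have hle (x : Plane) : ∑ i, ∑ k, ENNReal.ofReal |partialDeriv k (partialDeriv i u) x| ≤
        2 + tileSum N (fun y => ∑ i, ∑ k,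
          ENNReal.ofReal |partialDeriv k (partialDeriv i w) y|) x := by
      obtain ⟨y, -, hy⟩ := exists_tileSum_eq N x
      rw [hy _ fun z hz => by simp [hz'' _ _ z hz]]
      have h1 (i k : Fin 2) : ENNReal.ofReal |partialDeriv k (partialDeriv i u) x| ≤
          (if i = k then 1 else 0) + ENNReal.ofReal |partialDeriv k (partialDeriv i w) y| := by
        rw [hu2, hy _ (hz'' _ _)]
        refine (ENNReal.ofReal_le_ofReal (abs_add_le _ _)).trans ?_
        rw [ENNReal.ofReal_add (abs_nonneg _) (abs_nonneg _)]
        split_ifs <;> simp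
      refine (Finset.sum_le_sum fun i _ => Finset.sum_le_sum fun k _ => h1 i k).trans ?_
      simp [Finset.sum_add_distrib]
    have hm : Measurable fun y => ∑ i, ∑ k,
        ENNReal.ofReal |partialDeriv k (partialDeriv i w) y| :=
      Finset.measurable_fun_sum _ fun i _ => Finset.measurable_fun_sum _ fun k _ =>
        (hw'' i k).abs.measurable.ennreal_ofReal
    refine (lintegral_mono hle).trans ?_
    rw [lintegral_add_left measurable_const, setLIntegral_tileSum (by exact_mod_cast hN0) hm
      fun z hz => by simp [hz'' _ _ z hz], lintegral_const, Measure.restrict_apply_univ,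
      ENNReal.ofReal_add (by positivity) zero_le_one, ENNReal.ofReal_mul zero_le_two]
    refine add_le_add (mul_le_mul' (by simp) ((measure_mono unitSquare_subset_ball).trans ?_))
      (by simpa using hw1)
    rw [EuclideanSpace.volume_ball_fin_two, mul_comm, ENNReal.ofReal_mul (by positivity)]
    exact mul_le_mul' (by simp [ENNReal.ofReal, Real.toNNReal, Real.pi_pos.le])
      (by norm_num [← ENNReal.ofReal_pow])
  -- Off the copies ∂_ii u = 1 has zero negative part, and 0^p = 0 since p ≠ 0; so the integrand is
  -- itself a sum of rescaled copies, and its integral is that of the profile.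
  · have hΦ : ENNReal.ofReal (max (-(1 + (0 : ℝ))) 0 ^ p) = 0 := by
      simp [Real.zero_rpow (by linarith : p ≠ 0)]
    have hm : Measurable fun y =>
        ENNReal.ofReal (max (-(1 + partialDeriv i (partialDeriv i w) y)) 0 ^ p) := by
      have := (hw'' i i).measurable
      fun_prop
    have h0 : ∀ z ∉ unitSquare,
        ENNReal.ofReal (max (-(1 + partialDeriv i (partialDeriv i w) z)) 0 ^ p) = 0 :=
      fun z hz => by rw [hz'' i i z hz, hΦ]
    refine (hwp i).trans_eq ?_
    rw [← setLIntegral_tileSum (N := N) (by exact_mod_cast hN0) hm h0]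
    refine lintegral_congr fun x => ?_
    simp only [hu2, if_true]
    exact (tileSum_comp N (hz'' i i)
      (Φ := fun t => ENNReal.ofReal (max (-(1 + t)) 0 ^ p)) hΦ x).symm
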